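/- For $v\in\mathbb{R}$ let $W^*_v$ be the set of all $z\in\mathbb{C}$ such that $$\left|z-\frac pq\right|<\frac1{|q|^{v+1}}$$ holds for infinitely many pairs $(p,q)$ of Gaussian integers $p,q\in\mathbb{Z}[i]$ with $q\neq0$ (the fractions $p/q$ need not be in lowest terms), and let $V^*_v=W^*_v\cap I^2$, where $I^2=\{x+iy : 0\le x<1,\ 0\le y<1\}$ is the unit square. Then the Hausdorff dimensions (with respect to the Euclidean metric on $\mathbb{C}$) satisfy $$\dim_{\mathrm H}V^*_v=\dim_{\mathrm H}W^*_v=\begin{cases}\dfrac{4}{v+1}&\text{when } v\ge1,\\[2mm] 2&\text{when } v\le1.\end{cases}$$ -/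

import Mathlib

/-- The set `W*_v` of `v`-approximable complex numbers: those `z` with
`|z - p/q| < 1 / |q|^(v+1)` for infinitely many pairs of Gaussian integers `p, q`, `q ≠ 0`.
The fractions `p/q` are not required to be in lowest terms. -/
def approximableSet (v : ℝ) : Set ℂ :=
  {z : ℂ | {pq : GaussianInt × GaussianInt | pq.2 ≠ 0 ∧
    ‖z - (pq.1 : ℂ) / (pq.2 : ℂ)‖ < 1 / ‖(pq.2 : ℂ)‖ ^ (v + 1)}.Infinite}

/-- The half-open unit square `I² = [0,1)²` in the complex plane. -/
def unitSquare : Set ℂ :=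
  {z : ℂ | (0 ≤ z.re ∧ z.re < 1) ∧ (0 ≤ z.im ∧ z.im < 1)}

/-- The set `V*_v = W*_v ∩ I²`. -/
def approximableSetInSquare (v : ℝ) : Set ℂ :=
  approximableSet v ∩ unitSquare

/-! Upper bound: in a bounded region a denominator `q` admits about |q|² numerators, so the natural
cover by discs of radius |q|^-(v+1) has s-dimensional sum of order ∑ |q|^(2-s(v+1)) over a planar
lattice, finite when s(v+1) > 4 (`dimH_approximableSet_le`). Lower bound, v ≥ 1: Dirichlet's theorem
and an area count put at least a multiple of ρ²n⁴ fractions of height about n in any disc of radius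
ρ (`eventually_exists_many_fractions`), with gaps of order n⁻². Spreading mass evenly over them and
iterating (`exists_refinement`) yields, for s < 4/(v+1), a limit measure carried by V*_v that gives
small discs mass O(r^s); the mass distribution principle concludes. For v ≤ 1, monotonicity in v
reduces to v = 1, where 4/(v+1) = 2 is the full dimension. -/

open MeasureTheory Metric Filter Topology

/-! ### Counting and separation of Gaussian integers and fractions -/

/-- The area of a closed disc, as a real number. -/
lemma volume_real_closedBall (a : ℂ) {r : ℝ} (hr : 0 ≤ r) :
    volume.real (closedBall a r) = r ^ 2 * Real.pi := by
  simp [Measure.real, Complex.volume_closedBall, ENNReal.toReal_ofReal hr, NNReal.coe_real_pi]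

/-- The area of an open disc, as a real number. -/
lemma volume_real_ball (a : ℂ) {r : ℝ} (hr : 0 ≤ r) :
    volume.real (ball a r) = r ^ 2 * Real.pi := by
  simp [Measure.real, Complex.volume_ball, ENNReal.toReal_ofReal hr, NNReal.coe_real_pi]

/-- A `δ`-separated set in a disc of radius `r` has at most `2 + 8 (r / δ) ^ 2` elements. -/
lemma card_le_of_separated {Y : Finset ℂ} {δ r : ℝ} {z : ℂ} (hδ : 0 < δ) (hr : 0 ≤ r)
    (hsep : (Y : Set ℂ).Pairwise fun a b => δ ≤ dist a b) (hY : ∀ y ∈ Y, dist y z ≤ r) :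
    (Y.card : ℝ) ≤ 2 + 8 * (r / δ) ^ 2 := by
  have hdisj : (Y : Set ℂ).PairwiseDisjoint fun y => ball y (δ / 2) := by
    intro a ha b hb hab
    exact ball_disjoint_ball (by linarith [hsep ha hb hab])
  have hsub : (⋃ y ∈ Y, ball y (δ / 2)) ⊆ ball z (r + δ / 2) := by
    refine Set.iUnion₂_subset fun y hy => ball_subset_ball' ?_
    linarith [hY y hy]
  have h1 : volume.real (⋃ y ∈ Y, ball y (δ / 2)) = Y.card * ((δ / 2) ^ 2 * Real.pi) := by
    rw [measureReal_biUnion_finset hdisj (fun y _ => measurableSet_ball)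
      (fun y _ => measure_ball_lt_top.ne)]
    rw [Finset.sum_congr rfl fun y _ => volume_real_ball y (half_pos hδ).le]
    simp
  have h2 := measureReal_mono hsub (μ := volume) measure_ball_lt_top.ne
  rw [h1, volume_real_ball z (by positivity), ← mul_assoc] at h2
  have h3 := le_of_mul_le_mul_right h2 Real.pi_pos
  have h4 : (Y.card : ℝ) ≤ (1 + 2 * (r / δ)) ^ 2 := by
    have : (1 + 2 * (r / δ)) ^ 2 = (r + δ / 2) ^ 2 / (δ / 2) ^ 2 := by
      field_simp
      ring
    rw [this, le_div_iff₀ (by positivity)]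
    exact h3
  nlinarith [sq_nonneg (1 - 2 * (r / δ))]

lemma GaussianInt.one_le_norm_toComplex {q : GaussianInt} (hq : q ≠ 0) : 1 ≤ ‖(q : ℂ)‖ := by
  have h1 : (1 : ℝ) ≤ (q.norm : ℝ) := by exact_mod_cast GaussianInt.norm_pos.2 hq
  rw [GaussianInt.intCast_real_norm, Complex.normSq_eq_norm_sq] at h1
  nlinarith [_root_.norm_nonneg (q : ℂ)]

lemma GaussianInt.one_le_dist_toComplex {p q : GaussianInt} (h : p ≠ q) :
    1 ≤ dist (p : ℂ) (q : ℂ) := by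
  rw [dist_eq_norm, ← GaussianInt.toComplex_sub]
  exact GaussianInt.one_le_norm_toComplex (sub_ne_zero.2 h)

/-- Distinct Gaussian fractions with denominators at most `Q` are `1 / Q ^ 2`-separated. -/
lemma GaussianInt.le_dist_div {p q p' q' : GaussianInt} (hq : q ≠ 0) (hq' : q' ≠ 0) {Q : ℝ}
    (hQ : ‖(q : ℂ)‖ ≤ Q) (hQ' : ‖(q' : ℂ)‖ ≤ Q)
    (h : (p : ℂ) / (q : ℂ) ≠ (p' : ℂ) / (q' : ℂ)) :
    1 / Q ^ 2 ≤ dist ((p : ℂ) / (q : ℂ)) ((p' : ℂ) / (q' : ℂ)) := by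
  have hc : (q : ℂ) ≠ 0 := by simpa using hq
  have hc' : (q' : ℂ) ≠ 0 := by simpa using hq'
  have h1 := GaussianInt.one_le_norm_toComplex hq
  have h1' := GaussianInt.one_le_norm_toComplex hq'
  -- The numerator of the difference is a nonzero Gaussian integer, hence of norm at least 1.
  have hne : p * q' - q * p' ≠ 0 := by
    intro h0
    apply h
    rw [div_eq_div_iff hc hc', ← GaussianInt.toComplex_mul, ← GaussianInt.toComplex_mul]
    rw [sub_eq_zero.1 h0, mul_comm]
  have h2 := GaussianInt.one_le_norm_toComplex hne
  rw [dist_eq_norm, div_sub_div _ _ hc hc', norm_div, norm_mul]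
  rw [GaussianInt.toComplex_sub, GaussianInt.toComplex_mul, GaussianInt.toComplex_mul] at h2
  have : ‖(q : ℂ)‖ * ‖(q' : ℂ)‖ ≤ Q ^ 2 := by nlinarith
  gcongr

/-- A disc of radius `R` contains at most `2 + 8 R ^ 2` Gaussian integers. -/
lemma GaussianInt.card_le_of_dist_le {F : Finset GaussianInt} {w : ℂ} {R : ℝ} (hR : 0 ≤ R)
    (hF : ∀ p ∈ F, dist (p : ℂ) w ≤ R) : (F.card : ℝ) ≤ 2 + 8 * R ^ 2 := by
  classical
  rw [← Finset.card_image_of_injective F GaussianInt.toComplex_injective, ← div_one R]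
  refine card_le_of_separated one_pos hR (z := w) ?_ ?_
  · intro a ha b hb hab
    simp only [Finset.coe_image, Set.mem_image, SetLike.mem_coe] at ha hb
    obtain ⟨a, -, rfl⟩ := ha
    obtain ⟨b, -, rfl⟩ := hb
    exact GaussianInt.one_le_dist_toComplex fun h => hab (by rw [h])
  · simpa using hF

lemma GaussianInt.finite_setOf_dist_le (w : ℂ) (R : ℝ) :
    {p : GaussianInt | dist (p : ℂ) w ≤ R}.Finite := by
  by_contra hinf
  have hinf : {p : GaussianInt | dist (p : ℂ) w ≤ R}.Infinite := hinf
  obtain ⟨k, hk⟩ := exists_nat_gt (2 + 8 * R ^ 2)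
  obtain ⟨F, hF, rfl⟩ := hinf.exists_subset_card_eq k
  obtain ⟨p, hp⟩ := hinf.nonempty
  have hR : 0 ≤ R := dist_nonneg.trans hp
  exact absurd (GaussianInt.card_le_of_dist_le hR fun p hp => hF hp) (not_le.2 hk)

/-! ### Dirichlet's theorem and abundance of fractions -/

/-- **Dirichlet's approximation theorem** for Gaussian integers. -/
lemma GaussianInt.exists_norm_mul_sub_le (z : ℂ) {n : ℕ} (hn : 0 < n) :
    ∃ p q : GaussianInt, q ≠ 0 ∧ ‖(q : ℂ)‖ ≤ 2 * n ∧ ‖(q : ℂ) * z - p‖ ≤ 2 / n := by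
  classical
  have hn' : (0 : ℝ) < n := by exact_mod_cast hn
  -- Pigeonhole: (n+1)² multiples of z, reduced modulo the lattice, fall into n² cells of side 1/n.
  -- Bounding the norm by |re| + |im| produces the factors 2.
  let w : ℕ × ℕ → ℂ := fun a => ((⟨a.1, a.2⟩ : GaussianInt) : ℂ) * z
  let f : ℕ × ℕ → ℕ × ℕ := fun a => (⌊n * Int.fract (w a).re⌋₊, ⌊n * Int.fract (w a).im⌋₊)
  have hcell (t : ℝ) : ⌊n * Int.fract t⌋₊ < n := by
    rw [Nat.floor_lt (by positivity)]
    nlinarith [Int.fract_lt_one t]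
  have hclose (s t : ℝ) (h : ⌊n * Int.fract s⌋₊ = ⌊n * Int.fract t⌋₊) :
      |s - t - (⌊s⌋ - ⌊t⌋ : ℤ)| ≤ 1 / n := by
    have e : s - t - (⌊s⌋ - ⌊t⌋ : ℤ) = Int.fract s - Int.fract t := by
      push_cast
      rw [Int.fract, Int.fract]
      ring
    have h1 := Nat.floor_le (a := n * Int.fract s) (by positivity)
    have h2 := Nat.lt_floor_add_one (n * Int.fract s)
    have h3 := Nat.floor_le (a := n * Int.fract t) (by positivity)
    have h4 := Nat.lt_floor_add_one (n * Int.fract t)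
    rw [h] at h1 h2
    rw [e, abs_le, neg_le, le_div_iff₀ hn', le_div_iff₀ hn']
    constructor <;> nlinarith
  obtain ⟨a, ha, b, hb, hab, hfab⟩ := Finset.exists_ne_map_eq_of_card_lt_of_maps_to
    (s := Finset.range (n + 1) ×ˢ Finset.range (n + 1)) (t := Finset.range n ×ˢ Finset.range n)
    (f := f) (by simp only [Finset.card_product, Finset.card_range]; nlinarith)
    (by
      intro a _
      simp only [Finset.coe_product, Finset.coe_range, Set.mem_prod, Set.mem_Iio, f]
      exact ⟨hcell _, hcell _⟩)
  simp only [Finset.mem_product, Finset.mem_range] at ha hb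
  simp only [f, Prod.mk.injEq] at hfab
  refine ⟨⟨⌊(w a).re⌋ - ⌊(w b).re⌋, ⌊(w a).im⌋ - ⌊(w b).im⌋⟩,
    ⟨a.1, a.2⟩ - ⟨b.1, b.2⟩, ?_, ?_, ?_⟩
  · intro h
    apply hab
    have h' := sub_eq_zero.1 h
    simp only [Zsqrtd.mk.injEq, Nat.cast_inj] at h'
    exact Prod.ext h'.1 h'.2
  · refine (Complex.norm_le_abs_re_add_abs_im _).trans ?_
    have key (i j : ℕ) (hi : i < n + 1) (hj : j < n + 1) : |(i : ℝ) - j| ≤ n := by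
      have hi' : (i : ℝ) ≤ n := by exact_mod_cast Nat.lt_succ_iff.1 hi
      have hj' : (j : ℝ) ≤ n := by exact_mod_cast Nat.lt_succ_iff.1 hj
      rw [abs_le]
      constructor <;> linarith [(Nat.cast_nonneg i : (0 : ℝ) ≤ i), (Nat.cast_nonneg j : (0 : ℝ) ≤ j)]
    have h1 := key _ _ ha.1 hb.1
    have h2 := key _ _ ha.2 hb.2
    simp only [GaussianInt.toComplex_sub, Complex.sub_re, Complex.sub_im,
      GaussianInt.re_toComplex, GaussianInt.im_toComplex, Int.cast_natCast]
    linarith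
  · refine (Complex.norm_le_abs_re_add_abs_im _).trans ?_
    have h1 := hclose _ _ hfab.1
    have h2 := hclose _ _ hfab.2
    have e : (((⟨a.1, a.2⟩ - ⟨b.1, b.2⟩ : GaussianInt) : ℂ)) * z = w a - w b := by
      simp only [w, GaussianInt.toComplex_sub]
      ring
    rw [e]
    simp only [Complex.sub_re, Complex.sub_im, GaussianInt.re_toComplex, GaussianInt.im_toComplex]
    have : (2 : ℝ) / n = 1 / n + 1 / n := by ring
    linarith

/-- Area estimate for the neighbourhoods of the fractions with small denominators. -/
lemma sum_volume_small_denominators_le {S : Finset GaussianInt} {P : GaussianInt → Finset GaussianInt}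
    {x : ℂ} {ρ R c : ℝ} (hρ : 0 < ρ) (hR : 0 ≤ R) (hc : 0 ≤ c)
    (hS : ∀ q ∈ S, q ≠ 0 ∧ ‖(q : ℂ)‖ ≤ R)
    (hP : ∀ q, ∀ p ∈ P q, dist (p : ℂ) (q * x) ≤ ‖(q : ℂ)‖ * ρ) :
    volume.real (⋃ q ∈ S, ⋃ p ∈ P q, closedBall ((p : ℂ) / (q : ℂ)) (c / ‖(q : ℂ)‖)) ≤
      c ^ 2 * Real.pi * (10 * ρ ^ 2 * (2 + 8 * R ^ 2) + 10 * (2 + 8 * (1 / ρ) ^ 2)) := by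
  classical
  -- The constant 2 in the count of numerators matters only for ‖q‖ ≤ 1/ρ; the number of such q is
  -- bounded in terms of ρ alone.
  have hterm : ∀ q ∈ S,
      volume.real (⋃ p ∈ P q, closedBall ((p : ℂ) / (q : ℂ)) (c / ‖(q : ℂ)‖)) ≤
        c ^ 2 * Real.pi * (10 * ρ ^ 2 + if ‖(q : ℂ)‖ ≤ 1 / ρ then 10 else 0) := by
    intro q hq
    have h1 := GaussianInt.one_le_norm_toComplex (hS q hq).1
    have hcard := GaussianInt.card_le_of_dist_le (by positivity) (hP q)
    refine (measureReal_biUnion_finset_le _ _).trans ?_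
    rw [Finset.sum_congr rfl fun p _ => volume_real_closedBall _ (by positivity)]
    rw [Finset.sum_const, nsmul_eq_mul]
    calc ((P q).card : ℝ) * ((c / ‖(q : ℂ)‖) ^ 2 * Real.pi)
        ≤ (2 + 8 * (‖(q : ℂ)‖ * ρ) ^ 2) * ((c / ‖(q : ℂ)‖) ^ 2 * Real.pi) := by gcongr
      _ = c ^ 2 * Real.pi * (2 / ‖(q : ℂ)‖ ^ 2 + 8 * ρ ^ 2) := by field_simp
      _ ≤ _ := by
        refine mul_le_mul_of_nonneg_left ?_ (by positivity)
        split_ifs with h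
        · have : 2 / ‖(q : ℂ)‖ ^ 2 ≤ 2 := by
            rw [div_le_iff₀ (by positivity)]
            nlinarith
          nlinarith
        · have h2 : 1 ≤ ‖(q : ℂ)‖ * ρ := by
            rw [not_le, div_lt_iff₀ hρ] at h
            exact h.le
          have : 2 / ‖(q : ℂ)‖ ^ 2 ≤ 2 * ρ ^ 2 := by
            rw [div_le_iff₀ (by positivity)]
            nlinarith
          linarith
  refine (measureReal_biUnion_finset_le _ _).trans ((Finset.sum_le_sum hterm).trans ?_)
  rw [← Finset.mul_sum, Finset.sum_add_distrib, Finset.sum_const, nsmul_eq_mul, ← Finset.sum_filter,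
    Finset.sum_const, nsmul_eq_mul]
  have hc1 : (S.card : ℝ) ≤ 2 + 8 * R ^ 2 :=
    GaussianInt.card_le_of_dist_le hR (w := 0) fun q hq => by simpa using (hS q hq).2
  have hc2 : ((S.filter fun q : GaussianInt => ‖(q : ℂ)‖ ≤ 1 / ρ).card : ℝ) ≤ 2 + 8 * (1 / ρ) ^ 2 := by
    refine GaussianInt.card_le_of_dist_le (R := 1 / ρ) (by positivity) (w := 0) fun q hq => ?_
    rw [dist_zero_right]
    exact (Finset.mem_filter.1 hq).2
  have hpi : 0 ≤ c ^ 2 * Real.pi := by positivity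
  refine mul_le_mul_of_nonneg_left ?_ hpi
  nlinarith [sq_nonneg ρ]

/-- Every disc of radius `ρ` contains many Gaussian fractions whose denominators are comparable
to a given large `n`. -/
lemma eventually_exists_many_fractions {ρ : ℝ} (hρ : 0 < ρ) :
    ∀ᶠ n : ℕ in atTop, ∀ x : ℂ, ∃ Y : Finset ℂ,
      (∀ y ∈ Y, dist y x ≤ ρ ∧ ∃ p q : GaussianInt, q ≠ 0 ∧ (n : ℝ) / 100 ≤ ‖(q : ℂ)‖ ∧
        ‖(q : ℂ)‖ ≤ 2 * n ∧ y = (p : ℂ) / (q : ℂ)) ∧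
      ρ ^ 2 * (n : ℝ) ^ 4 / 320000 ≤ Y.card := by
  classical
  have hlim1 : ∀ᶠ n : ℕ in atTop, 4 / ρ ≤ (n : ℝ) :=
    tendsto_natCast_atTop_atTop.eventually_ge_atTop _
  have hlim2 : ∀ᶠ n : ℕ in atTop,
      (4 * (10 * ρ ^ 2 * 2 + 10 * (2 + 8 * (1 / ρ) ^ 2))) / (ρ ^ 2 / 16) ≤ (n : ℝ) :=
    tendsto_natCast_atTop_atTop.eventually_ge_atTop _
  filter_upwards [hlim1, hlim2, eventually_ge_atTop 1] with n h1 h2 hn1 x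
  have hn : (1 : ℝ) ≤ n := by exact_mod_cast hn1
  have hn0 : (0 : ℝ) < n := by linarith
  let D : Finset GaussianInt := (GaussianInt.finite_setOf_dist_le 0 (2 * n)).toFinset.filter (· ≠ 0)
  let S : Finset GaussianInt := D.filter fun q : GaussianInt => ‖(q : ℂ)‖ ≤ n / 100
  let T : Finset GaussianInt := D.filter fun q : GaussianInt => (n : ℝ) / 100 ≤ ‖(q : ℂ)‖
  let P : GaussianInt → Finset GaussianInt := fun q =>
    (GaussianInt.finite_setOf_dist_le ((q : ℂ) * x) (‖(q : ℂ)‖ * ρ)).toFinset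
  have hmemP (p q : GaussianInt) : p ∈ P q ↔ dist (p : ℂ) (q * x) ≤ ‖(q : ℂ)‖ * ρ := by simp [P]
  let Y : Finset ℂ := T.biUnion fun q => (P q).image fun p : GaussianInt => (p : ℂ) / (q : ℂ)
  refine ⟨Y, ?_, ?_⟩
  · intro y hy
    simp only [Y, Finset.mem_biUnion, Finset.mem_image] at hy
    obtain ⟨q, hq, p, hp, rfl⟩ := hy
    simp only [T, D, Finset.mem_filter, Set.Finite.mem_toFinset, Set.mem_ofPred_eq,
      dist_zero_right] at hq
    have hq1 := GaussianInt.one_le_norm_toComplex hq.1.2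
    have hc : (q : ℂ) ≠ 0 := by simpa using hq.1.2
    refine ⟨?_, p, q, hq.1.2, hq.2, hq.1.1, rfl⟩
    rw [hmemP, dist_eq_norm] at hp
    rw [dist_eq_norm, div_sub' hc, norm_div, div_le_iff₀ (by linarith), mul_comm ρ]
    exact hp
  -- Up to a factor π, the disc has area ρ²/4, and denominators up to n/100 cover at most ρ²/16 +
  -- 0.032ρ². The other fractions must cover ρ²/8 with discs of radius 200/n², whence 320000 = 8 ·
  -- 200².
  · have hcover : ball x (ρ / 2) ⊆
        (⋃ q ∈ S, ⋃ p ∈ P q, closedBall ((p : ℂ) / (q : ℂ)) (2 / n / ‖(q : ℂ)‖)) ∪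
          ⋃ y ∈ Y, closedBall y (200 / n ^ 2) := by
      intro z hz
      obtain ⟨p, q, hq0, hqn, hpq⟩ := GaussianInt.exists_norm_mul_sub_le z hn1
      have hq1 := GaussianInt.one_le_norm_toComplex hq0
      have hc : (q : ℂ) ≠ 0 := by simpa using hq0
      have hqD : q ∈ D := by simp [D, hq0, hqn]
      have hdist : dist z ((p : ℂ) / (q : ℂ)) ≤ 2 / n / ‖(q : ℂ)‖ := by
        rw [dist_eq_norm, sub_div' hc, norm_div, mul_comm z]
        gcongr
      have hpP : p ∈ P q := by
        rw [hmemP, dist_comm, dist_eq_norm]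
        rw [mem_ball, dist_eq_norm] at hz
        have h4 : 2 / (n : ℝ) ≤ ρ / 2 := by
          rw [div_le_iff₀ hρ] at h1
          rw [div_le_iff₀ hn0]
          linarith
        have e : (q : ℂ) * x - p = ((q : ℂ) * z - p) - q * (z - x) := by ring
        rw [e]
        refine (norm_sub_le _ _).trans ?_
        rw [norm_mul]
        nlinarith
      rcases le_total ‖(q : ℂ)‖ (n / 100) with h | h
      · left
        simp only [Set.mem_iUnion]
        exact ⟨q, Finset.mem_filter.2 ⟨hqD, h⟩, p, hpP, hdist⟩
      · right
        simp only [Set.mem_iUnion]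
        refine ⟨(p : ℂ) / (q : ℂ), Finset.mem_biUnion.2 ⟨q, Finset.mem_filter.2 ⟨hqD, h⟩,
          Finset.mem_image_of_mem _ hpP⟩, hdist.trans ?_⟩
        rw [div_div, div_le_div_iff₀ (by positivity) (by positivity)]
        nlinarith
    have hS : ∀ q ∈ S, q ≠ 0 ∧ ‖(q : ℂ)‖ ≤ n / 100 := by
      intro q hq
      simp only [S, D, Finset.mem_filter] at hq
      exact ⟨hq.1.2, hq.2⟩
    have hsmall := sum_volume_small_denominators_le hρ (R := n / 100) (c := 2 / n) (P := P) (x := x)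
      (by positivity) (by positivity) hS fun q p hp => (hmemP p q).1 hp
    have hlarge : volume.real (⋃ y ∈ Y, closedBall y (200 / (n : ℝ) ^ 2)) ≤
        Y.card * ((200 / (n : ℝ) ^ 2) ^ 2 * Real.pi) := by
      refine (measureReal_biUnion_finset_le _ _).trans ?_
      rw [Finset.sum_congr rfl fun y _ => volume_real_closedBall y (by positivity)]
      simp
    have hfin : volume ((⋃ q ∈ S, ⋃ p ∈ P q, closedBall ((p : ℂ) / (q : ℂ)) (2 / n / ‖(q : ℂ)‖)) ∪
          ⋃ y ∈ Y, closedBall y (200 / (n : ℝ) ^ 2)) ≠ ⊤ := by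
      refine (IsCompact.union ?_ ?_).measure_lt_top.ne
      · exact S.isCompact_biUnion fun q _ => (P q).isCompact_biUnion fun p _ =>
          isCompact_closedBall _ _
      · exact Y.isCompact_biUnion fun y _ => isCompact_closedBall _ _
    have hvol := (measureReal_mono hcover hfin).trans ((measureReal_union_le _ _).trans
      (add_le_add hsmall hlarge))
    rw [volume_real_ball x (by positivity)] at hvol
    have hvol2 : (ρ / 2) ^ 2 ≤ (2 / (n : ℝ)) ^ 2 *
        (10 * ρ ^ 2 * (2 + 8 * (n / 100 : ℝ) ^ 2) + 10 * (2 + 8 * (1 / ρ) ^ 2)) +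
        Y.card * (200 / (n : ℝ) ^ 2) ^ 2 := by
      refine le_of_mul_le_mul_right ?_ Real.pi_pos
      linarith
    have hsplit : (2 / (n : ℝ)) ^ 2 *
        (10 * ρ ^ 2 * (2 + 8 * (n / 100 : ℝ) ^ 2) + 10 * (2 + 8 * (1 / ρ) ^ 2)) =
        (4 * (10 * ρ ^ 2 * 2 + 10 * (2 + 8 * (1 / ρ) ^ 2))) / (n : ℝ) ^ 2 +
          320 / 10000 * ρ ^ 2 := by
      field_simp
      ring
    have hrem : (4 * (10 * ρ ^ 2 * 2 + 10 * (2 + 8 * (1 / ρ) ^ 2))) / (n : ℝ) ^ 2 ≤ ρ ^ 2 / 16 := by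
      rw [div_le_iff₀ (by positivity)] at h2
      rw [div_le_iff₀ (by positivity)]
      refine h2.trans ?_
      nlinarith [mul_pos hρ hρ]
    have hfinal : ρ ^ 2 / 8 ≤ Y.card * (200 / (n : ℝ) ^ 2) ^ 2 := by
      rw [hsplit] at hvol2
      nlinarith [mul_pos hρ hρ]
    have e : (200 / (n : ℝ) ^ 2) ^ 2 = 40000 / (n : ℝ) ^ 4 := by
      field_simp
      norm_num
    rw [e, mul_div_assoc', le_div_iff₀ (by positivity)] at hfinal
    linarith

/-! ### One step of the Cantor construction -/

/-- A uniform measure on a finite set of Gaussian fractions of height about `n` charges a disc of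
radius `r` in proportion to the number of fractions it can contain. -/
lemma uniformOfFinset_closedBall_le {Y : Finset ℂ} (hY : Y.Nonempty) {n : ℕ} {ρ r : ℝ}
    (hn : 0 < n) (hρ : 0 < ρ) (hr : 0 ≤ r)
    (hfrac : ∀ y ∈ Y, ∃ p q : GaussianInt, q ≠ 0 ∧ ‖(q : ℂ)‖ ≤ 2 * n ∧ y = (p : ℂ) / (q : ℂ))
    (hcard : ρ ^ 2 * (n : ℝ) ^ 4 / 320000 ≤ Y.card) (z : ℂ) :
    (PMF.uniformOfFinset Y hY).toOuterMeasure (closedBall z r) ≤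
      ENNReal.ofReal (320000 * (2 + 128 * r ^ 2 * (n : ℝ) ^ 4) / (ρ ^ 2 * (n : ℝ) ^ 4)) := by
  classical
  have hn' : (0 : ℝ) < n := by exact_mod_cast hn
  rw [PMF.toOuterMeasure_uniformOfFinset_apply]
  have hpos : (0 : ℝ) < Y.card := by exact_mod_cast hY.card_pos
  -- Heights at most 2n give separation 1/(2n)², and 8(4rn²)² = 128r²n⁴.
  have hin : ((Y.filter (· ∈ closedBall z r)).card : ℝ) ≤ 2 + 128 * r ^ 2 * (n : ℝ) ^ 4 := by
    have := card_le_of_separated (Y := Y.filter (· ∈ closedBall z r)) (δ := 1 / (2 * n : ℝ) ^ 2)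
      (r := r) (z := z) (by positivity) hr ?_ ?_
    · refine this.trans (le_of_eq ?_)
      field_simp
      ring
    · intro a ha b hb hab
      obtain ⟨p, q, hq, hqn, rfl⟩ := hfrac a (Finset.mem_filter.1 ha).1
      obtain ⟨p', q', hq', hqn', rfl⟩ := hfrac b (Finset.mem_filter.1 hb).1
      exact GaussianInt.le_dist_div hq hq' hqn hqn' hab
    · intro y hy
      exact (Finset.mem_filter.1 hy).2
  rw [← ENNReal.ofReal_natCast, ← ENNReal.ofReal_natCast, ← ENNReal.ofReal_div_of_pos hpos]
  refine ENNReal.ofReal_le_ofReal ?_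
  calc _ ≤ (2 + 128 * r ^ 2 * (n : ℝ) ^ 4) / (ρ ^ 2 * (n : ℝ) ^ 4 / 320000) := by gcongr
    _ = _ := by field_simp

/-- A mixture of measures supported within distance `ρ` of their base points. -/
lemma PMF.bind_closedBall_le_mul {μ : PMF ℂ} {κ : ℂ → PMF ℂ} {ρ r R : ℝ} {z : ℂ} {K : ENNReal}
    (hκ : ∀ x, ∀ y ∈ (κ x).support, dist y x ≤ ρ) (hR : r + ρ ≤ R)
    (hK : ∀ x, (κ x).toOuterMeasure (closedBall z r) ≤ K) :
    (μ.bind κ).toOuterMeasure (closedBall z r) ≤ μ.toOuterMeasure (closedBall z R) * K := by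
  rw [PMF.toOuterMeasure_bind_apply, PMF.toOuterMeasure_apply, ← ENNReal.tsum_mul_right]
  refine ENNReal.tsum_le_tsum fun x => ?_
  by_cases hx : x ∈ closedBall z R
  · rw [Set.indicator_of_mem hx]
    exact mul_le_mul_right (hK x) _
  · have : (κ x).toOuterMeasure (closedBall z r) = 0 := by
      rw [PMF.toOuterMeasure_apply_eq_zero_iff, Set.disjoint_left]
      intro y hy hyz
      apply hx
      have h1 := hκ x y hy
      rw [mem_closedBall] at hyz ⊢
      linarith [dist_triangle_left x z y]
    simp [this]

/-- The radius exponent condition `s (v + 1) < 4` makes the next radius small enough. -/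
lemma eventually_height_bounds {v s ρ : ℝ} (hv : 1 ≤ v) (hsv : s * (v + 1) < 4)
    (hρ : 0 < ρ) (K : ℝ) :
    ∀ᶠ n : ℕ in atTop, (2 * (n : ℝ)) ^ (-(v + 1)) / 4 ≤ ρ / 2 ∧
      K / (n : ℝ) ^ 4 ≤ ((2 * (n : ℝ)) ^ (-(v + 1)) / 4) ^ s := by
  have htop : Tendsto (fun n : ℕ => 2 * (n : ℝ)) atTop atTop :=
    tendsto_natCast_atTop_atTop.const_mul_atTop two_pos
  have h1 : ∀ᶠ n : ℕ in atTop, (2 * (n : ℝ)) ^ (-(v + 1)) < 2 * ρ :=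
    ((tendsto_rpow_neg_atTop (by linarith : 0 < v + 1)).comp htop).eventually_lt_const
      (by positivity)
  -- The positive exponent 4 - s(v+1) beats any constant; 16 comes from (2n)⁴ and 4^s from the
  -- division by 4.
  have h2 : ∀ᶠ n : ℕ in atTop, K * 16 * 4 ^ s < (2 * (n : ℝ)) ^ (4 - s * (v + 1)) :=
    ((tendsto_rpow_atTop (by linarith : 0 < 4 - s * (v + 1))).comp htop).eventually_gt_atTop _
  filter_upwards [h1, h2, eventually_gt_atTop 0] with n h1 h2 hn
  have hn' : (0 : ℝ) < n := by exact_mod_cast hn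
  refine ⟨by linarith, ?_⟩
  rw [Real.div_rpow (by positivity) (by positivity), ← Real.rpow_mul (by positivity),
    div_le_div_iff₀ (by positivity) (by positivity)]
  have e : (2 * (n : ℝ)) ^ (-(v + 1) * s) * (n : ℝ) ^ 4 = (2 * (n : ℝ)) ^ (4 - s * (v + 1)) / 16 := by
    rw [show 4 - s * (v + 1) = -(v + 1) * s + (4 : ℕ) by push_cast; ring,
      Real.rpow_add_natCast (by positivity)]
    ring
  rw [e]
  linarith

/-- One step of the Cantor construction: a measure satisfying a Frostman bound at scale `ρ` is
redistributed on nearby Gaussian fractions of large height, so that the Frostman bound holds at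
all scales down to a much smaller one. -/
lemma exists_refinement {v s A : ℝ} (hv : 1 ≤ v) (hs : 0 < s) (hsv : s * (v + 1) < 4) (hA : 0 ≤ A)
    (N : ℕ) {μ : PMF ℂ} {ρ : ℝ} (hρ : 0 < ρ)
    (hμ : ∀ z, μ.toOuterMeasure (closedBall z (6 * ρ)) ≤ ENNReal.ofReal (A * ρ ^ s)) :
    ∃ (μ' : PMF ℂ) (ρ' : ℝ), 0 < ρ' ∧ ρ' ≤ ρ / 2 ∧
      (∀ z, μ'.toOuterMeasure (closedBall z (6 * ρ')) ≤ ENNReal.ofReal (A * ρ' ^ s)) ∧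
      (∀ z r, ρ' ≤ r → r ≤ 5 * ρ →
        μ'.toOuterMeasure (closedBall z r) ≤ ENNReal.ofReal (2000000000 * A * r ^ s)) ∧
      (∀ z r, μ'.toOuterMeasure (closedBall z r) ≤ μ.toOuterMeasure (closedBall z (r + ρ))) ∧
      (∀ y ∈ μ'.support, ∃ x ∈ μ.support, dist y x ≤ ρ) ∧
      ∀ y ∈ μ'.support, ∃ p q : GaussianInt, q ≠ 0 ∧ N ≤ ‖(q : ℂ)‖ ∧
        4 * ρ' ≤ 1 / ‖(q : ℂ)‖ ^ (v + 1) ∧ y = (p : ℂ) / (q : ℂ) := by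
  have hs2 : s < 2 := by nlinarith
  have hlarge : ∀ᶠ n : ℕ in atTop, 100 * (N : ℝ) ≤ n :=
    tendsto_natCast_atTop_atTop.eventually_ge_atTop _
  obtain ⟨n, hY, ⟨hρ', hdecay⟩, hnN, hn1⟩ := ((eventually_exists_many_fractions hρ).and
    ((eventually_height_bounds hv hsv hρ (2000000000 * ρ ^ s / ρ ^ 2)).and
      (hlarge.and (eventually_ge_atTop 1)))).exists
  have hn : (1 : ℝ) ≤ n := by exact_mod_cast hn1
  choose Y hYmem hYcard using hY
  have hne (x : ℂ) : (Y x).Nonempty := by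
    rw [← Finset.card_pos]
    have : (0 : ℝ) < (Y x).card := lt_of_lt_of_le (by positivity) (hYcard x)
    exact_mod_cast this
  -- Since ‖q‖ ≤ 2n, the disc of radius 4ρ' about p/q lies in the disc of approximation.
  set ρ' : ℝ := (2 * (n : ℝ)) ^ (-(v + 1)) / 4 with hρ'def
  have hρ'pos : 0 < ρ' := by positivity
  let κ : ℂ → PMF ℂ := fun x => PMF.uniformOfFinset (Y x) (hne x)
  have hκ (x : ℂ) : ∀ y ∈ (κ x).support, dist y x ≤ ρ := fun y hy =>
    (hYmem x y ((PMF.mem_support_uniformOfFinset_iff _ _).1 hy)).1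
  have hball (z : ℂ) (r : ℝ) (hr : 0 ≤ r) (hr5 : r ≤ 5 * ρ) :
      (μ.bind κ).toOuterMeasure (closedBall z r) ≤ ENNReal.ofReal
        (A * (ρ ^ s / ρ ^ 2 * (640000 / (n : ℝ) ^ 4 + 40960000 * r ^ 2))) := by
    refine (PMF.bind_closedBall_le_mul hκ (R := 6 * ρ) (by linarith) fun x =>
      uniformOfFinset_closedBall_le (hne x) hn1 hρ hr (fun y hy => ?_) (hYcard x) z).trans ?_
    · obtain ⟨-, p, q, hq, -, hqn, rfl⟩ := hYmem x y hy
      exact ⟨p, q, hq, hqn, rfl⟩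
    · refine (mul_le_mul_left (hμ z) _).trans ?_
      rw [← ENNReal.ofReal_mul (by positivity)]
      refine ENNReal.ofReal_le_ofReal (le_of_eq ?_)
      field_simp
      ring
  -- Here v ≥ 1 enters: at radius 6ρ' the area term is then dominated by a multiple of n⁻⁴.
  have hρ'n : ρ' ^ 2 ≤ 1 / (n : ℝ) ^ 4 := by
    have h1 : ρ' ≤ 1 / (n : ℝ) ^ 2 := by
      have h2 : (2 * (n : ℝ)) ^ (-(v + 1)) ≤ (2 * (n : ℝ)) ^ (-2 : ℝ) :=
        Real.rpow_le_rpow_of_exponent_le (by linarith) (by linarith)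
      rw [Real.rpow_neg (by positivity), Real.rpow_neg (by positivity), Real.rpow_two] at h2
      rw [hρ'def, Real.rpow_neg (by positivity)]
      refine (div_le_self (by positivity) (by norm_num)).trans (h2.trans ?_)
      rw [one_div]
      gcongr
      linarith
    calc ρ' ^ 2 ≤ (1 / (n : ℝ) ^ 2) ^ 2 := by gcongr
      _ = 1 / (n : ℝ) ^ 4 := by ring
  refine ⟨μ.bind κ, ρ', hρ'pos, hρ', fun z => ?_, fun z r hr hr5 => ?_, fun z r => ?_,
    fun y hy => ?_, fun y hy => ?_⟩
  -- At the new scale the constant `A` is recovered without loss, so the step can be iterated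
  -- indefinitely; only intermediate scales pay the fixed factor.
  · refine (hball z _ (by positivity) (by linarith)).trans (ENNReal.ofReal_le_ofReal ?_)
    refine mul_le_mul_of_nonneg_left (le_trans ?_ hdecay) hA
    calc ρ ^ s / ρ ^ 2 * (640000 / (n : ℝ) ^ 4 + 40960000 * (6 * ρ') ^ 2)
        = ρ ^ s / ρ ^ 2 * (640000 / (n : ℝ) ^ 4 + 1474560000 * ρ' ^ 2) := by ring
      _ ≤ ρ ^ s / ρ ^ 2 * (640000 / (n : ℝ) ^ 4 + 1474560000 * (1 / (n : ℝ) ^ 4)) := by gcongr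
      _ = 1475200000 * (ρ ^ s / ρ ^ 2 / (n : ℝ) ^ 4) := by ring
      _ ≤ 2000000000 * (ρ ^ s / ρ ^ 2 / (n : ℝ) ^ 4) := by gcongr; norm_num
      _ = _ := by ring
  · have hr0 : 0 < r := hρ'pos.trans_le hr
    refine (hball z r hr0.le hr5).trans (ENNReal.ofReal_le_ofReal ?_)
    rw [mul_comm _ A, mul_assoc]
    refine mul_le_mul_of_nonneg_left ?_ hA
    have h1 : ρ ^ s / ρ ^ 2 * (640000 / (n : ℝ) ^ 4) ≤ r ^ s :=
      calc ρ ^ s / ρ ^ 2 * (640000 / (n : ℝ) ^ 4) = 640000 * (ρ ^ s / ρ ^ 2 / (n : ℝ) ^ 4) := by ring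
        _ ≤ 2000000000 * (ρ ^ s / ρ ^ 2 / (n : ℝ) ^ 4) := by gcongr; norm_num
        _ = 2000000000 * ρ ^ s / ρ ^ 2 / (n : ℝ) ^ 4 := by ring
        _ ≤ ρ' ^ s := hdecay
        _ ≤ r ^ s := Real.rpow_le_rpow hρ'pos.le hr hs.le
    -- As s < 2 and r ≤ 5ρ, the area term costs at most 5² relative to r^s.
    have h2 : ρ ^ s / ρ ^ 2 * r ^ 2 ≤ 25 * r ^ s := by
      have h3 : (r / ρ) ^ (2 - s) ≤ 5 ^ (2 : ℝ) :=
        calc (r / ρ) ^ (2 - s) ≤ 5 ^ (2 - s) := by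
              refine Real.rpow_le_rpow (by positivity) ?_ (by linarith)
              rwa [div_le_iff₀ hρ]
          _ ≤ 5 ^ (2 : ℝ) := Real.rpow_le_rpow_of_exponent_le (by norm_num) (by linarith)
      have h4 : ρ ^ s / ρ ^ 2 * r ^ 2 = (r / ρ) ^ (2 - s) * r ^ s := by
        rw [Real.div_rpow hr0.le hρ.le, Real.rpow_sub hr0, Real.rpow_sub hρ, Real.rpow_two,
          Real.rpow_two]
        have := Real.rpow_pos_of_pos hρ s
        have := Real.rpow_pos_of_pos hr0 s
        field_simp
      rw [h4]
      rw [Real.rpow_two] at h3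
      have := Real.rpow_pos_of_pos hr0 s
      nlinarith
    have := Real.rpow_pos_of_pos hr0 s
    nlinarith
  · refine (PMF.bind_closedBall_le_mul hκ le_rfl (K := 1) fun x => ?_).trans (by rw [mul_one])
    exact ((κ x).toOuterMeasure.mono (Set.subset_univ _)).trans
      ((PMF.toOuterMeasure_apply_eq_one_iff (κ x) _).2 (Set.subset_univ _)).le
  · obtain ⟨x, hx, hy⟩ := (PMF.mem_support_bind_iff _ _ _).1 hy
    exact ⟨x, hx, hκ x y hy⟩
  · obtain ⟨x, hx, hy⟩ := (PMF.mem_support_bind_iff _ _ _).1 hy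
    obtain ⟨-, p, q, hq, hnq, hqn, rfl⟩ := hYmem x y ((PMF.mem_support_uniformOfFinset_iff _ _).1 hy)
    have hq1 := GaussianInt.one_le_norm_toComplex hq
    refine ⟨p, q, hq, by linarith, ?_, rfl⟩
    rw [hρ'def, Real.rpow_neg (by positivity), one_div, mul_div_cancel₀ _ (by norm_num)]
    refine inv_anti₀ (by positivity) ?_
    exact Real.rpow_le_rpow (by positivity) hqn (by linarith)

/-! ### Limit measure and mass distribution -/

/-- Points charged at a late stage are close to points charged at an early stage. -/
lemma exists_mem_support_dist_le {μ : ℕ → PMF ℂ} {ρ : ℕ → ℝ} (hρ : ∀ k, 0 < ρ k)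
    (hhalf : ∀ k, ρ (k + 1) ≤ ρ k / 2)
    (hsupp : ∀ k, ∀ y ∈ (μ (k + 1)).support, ∃ x ∈ (μ k).support, dist y x ≤ ρ k)
    {k j : ℕ} (hkj : k ≤ j) : ∀ y ∈ (μ j).support, ∃ x ∈ (μ k).support, dist y x ≤ 2 * ρ k := by
  -- The correction -2ρ_j closes the induction, since ρ_j ≤ 2ρ_j - 2ρ_(j+1).
  suffices h : ∀ y ∈ (μ j).support, ∃ x ∈ (μ k).support, dist y x ≤ 2 * ρ k - 2 * ρ j by
    intro y hy
    obtain ⟨x, hx, hyx⟩ := h y hy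
    exact ⟨x, hx, by linarith [hρ j]⟩
  induction j, hkj using Nat.le_induction with
  | base => exact fun y hy => ⟨y, hy, by simp⟩
  | succ j hkj ih =>
    intro y hy
    obtain ⟨w, hw, hyw⟩ := hsupp j y hy
    obtain ⟨x, hx, hwx⟩ := ih w hw
    exact ⟨x, hx, by linarith [dist_triangle y w x, hhalf j]⟩

/-- Late stages charge a disc at most as much as an early stage charges a slightly larger one. -/
lemma toOuterMeasure_closedBall_le_of_le {μ : ℕ → PMF ℂ} {ρ : ℕ → ℝ} (hρ : ∀ k, 0 < ρ k)
    (hhalf : ∀ k, ρ (k + 1) ≤ ρ k / 2)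
    (hball : ∀ k z r, (μ (k + 1)).toOuterMeasure (closedBall z r) ≤
      (μ k).toOuterMeasure (closedBall z (r + ρ k)))
    {k j : ℕ} (hkj : k ≤ j) (z : ℂ) (r : ℝ) :
    (μ j).toOuterMeasure (closedBall z r) ≤ (μ k).toOuterMeasure (closedBall z (r + 2 * ρ k)) := by
  suffices h : ∀ r, (μ j).toOuterMeasure (closedBall z r) ≤
      (μ k).toOuterMeasure (closedBall z (r + 2 * ρ k - 2 * ρ j)) from
    (h r).trans ((μ k).toOuterMeasure.mono (closedBall_subset_closedBall (by linarith [hρ j])))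
  induction j, hkj using Nat.le_induction with
  | base => intro r; simp
  | succ j hkj ih =>
    intro r
    refine (hball j z r).trans ((ih _).trans ?_)
    exact (μ k).toOuterMeasure.mono (closedBall_subset_closedBall (by linarith [hhalf j]))

/-- The limit measure of the Cantor construction. -/
lemma exists_limit_measure {μ : ℕ → PMF ℂ} {ρ : ℕ → ℝ} {C s : ℝ} {x₀ : ℂ} (hC : 0 ≤ C)
    (hs : 0 ≤ s) (hρ : ∀ k, 0 < ρ k) (hhalf : ∀ k, ρ (k + 1) ≤ ρ k / 2)
    (hμ0 : (μ 0).support = {x₀})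
    (hsupp : ∀ k, ∀ y ∈ (μ (k + 1)).support, ∃ x ∈ (μ k).support, dist y x ≤ ρ k)
    (hball : ∀ k z r, (μ (k + 1)).toOuterMeasure (closedBall z r) ≤
      (μ k).toOuterMeasure (closedBall z (r + ρ k)))
    (hfrost : ∀ k z r, ρ (k + 1) ≤ r → r ≤ 5 * ρ k →
      (μ (k + 1)).toOuterMeasure (closedBall z r) ≤ ENNReal.ofReal (C * r ^ s)) :
    ∃ ν : Measure ℂ, IsProbabilityMeasure ν ∧
      (∀ k, ν (cthickening (2 * ρ k) (μ k).support)ᶜ = 0) ∧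
      ∀ z r, 0 < r → r < ρ 0 → ν (ball z r) ≤ ENNReal.ofReal (C * (3 * r) ^ s) := by
  let P : ℕ → ProbabilityMeasure ℂ := fun k => ⟨(μ k).toMeasure, inferInstance⟩
  have hP (k : ℕ) {S : Set ℂ} (hS : MeasurableSet S) :
      (P k : Measure ℂ) S = (μ k).toOuterMeasure S := PMF.toMeasure_apply_eq_toOuterMeasure_apply _ hS
  have hnull (k j : ℕ) (hkj : k ≤ j) :
      (P j : Measure ℂ) (cthickening (2 * ρ k) (μ k).support)ᶜ = 0 := by
    rw [hP j isClosed_cthickening.measurableSet.compl, PMF.toOuterMeasure_apply_eq_zero_iff,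
      Set.disjoint_compl_right_iff_subset]
    intro y hy
    obtain ⟨x, hx, hyx⟩ := exists_mem_support_dist_le hρ hhalf hsupp hkj y hy
    exact mem_cthickening_of_dist_le y x _ _ hx hyx
  have htight : IsTightMeasureSet {((Q : ProbabilityMeasure ℂ) : Measure ℂ) | Q ∈ Set.range P} := by
    rw [isTightMeasureSet_iff_exists_isCompact_measure_compl_le]
    intro ε _
    refine ⟨cthickening (2 * ρ 0) (μ 0).support, ?_, ?_⟩
    · rw [hμ0]
      exact isCompact_singleton.cthickening
    · rintro _ ⟨_, ⟨j, rfl⟩, rfl⟩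
      rw [hnull 0 j (Nat.zero_le _)]
      exact zero_le
  -- All stages live on one compact set, so an ultrafilter limit exists. Both required bounds
  -- concern open sets, where the mass of the limit is at most the liminf.
  obtain ⟨ν, -, hν⟩ := (isCompact_closure_of_isTightMeasureSet htight).ultrafilter_le_nhds
    (Ultrafilter.map P (hyperfilter ℕ)) (by
      rw [le_principal_iff]
      exact Ultrafilter.mem_map.2 (Filter.univ_mem' fun j => subset_closure ⟨j, rfl⟩))
  have hlim : Tendsto P (hyperfilter ℕ) (𝓝 ν) := hν
  have hev (k : ℕ) : ∀ᶠ j in (hyperfilter ℕ : Filter ℕ), k ≤ j :=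
    Nat.hyperfilter_le_atTop (eventually_ge_atTop k)
  refine ⟨ν, inferInstance, fun k => ?_, fun z r hr hr0 => ?_⟩
  · have h := ProbabilityMeasure.le_liminf_measure_open_of_tendsto hlim
      (isClosed_cthickening (δ := 2 * ρ k) (E := (μ k).support)).isOpen_compl
    refine le_antisymm (h.trans ?_) zero_le
    refine (liminf_le_liminf ((hev k).mono fun j hj => (hnull k j hj).le)).trans ?_
    rw [liminf_const]
  · have hpow (k : ℕ) : ρ k ≤ ρ 0 * (1 / 2) ^ k := by
      induction k with
      | zero => simp
      | succ k ih => rw [pow_succ]; linarith [hhalf k]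
    have hex : ∃ k, ρ k ≤ r := by
      obtain ⟨k, hk⟩ := exists_pow_lt_of_lt_one (div_pos hr (hρ 0)) (by norm_num : (1 / 2 : ℝ) < 1)
      refine ⟨k, (hpow k).trans ?_⟩
      rw [lt_div_iff₀ (hρ 0)] at hk
      linarith
    classical
    -- With ρ_(m+1) ≤ r < ρ_m, the enlarged radius r + 2ρ_(m+1) is at most 3r < 5ρ_m, within the
    -- range of `hfrost`.
    obtain ⟨m, hm⟩ : ∃ m, Nat.find hex = m + 1 := Nat.exists_eq_succ_of_ne_zero fun h0 => by
      have := Nat.find_spec hex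
      rw [h0] at this
      linarith
    have hle : ρ (m + 1) ≤ r := hm ▸ Nat.find_spec hex
    have hlt : r < ρ m := not_le.1 (Nat.find_min hex (by omega))
    have h := ProbabilityMeasure.le_liminf_measure_open_of_tendsto hlim (isOpen_ball (x := z) (ε := r))
    refine h.trans ?_
    refine (liminf_le_liminf (v := fun _ => ENNReal.ofReal (C * (3 * r) ^ s))
      ((hev (m + 1)).mono fun j hj => ?_)).trans ?_
    · have h1 := hρ (m + 1)
      calc (P j : Measure ℂ) (ball z r) ≤ (P j : Measure ℂ) (closedBall z r) :=
            measure_mono ball_subset_closedBall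
        _ = (μ j).toOuterMeasure (closedBall z r) := hP j measurableSet_closedBall
        _ ≤ _ := toOuterMeasure_closedBall_le_of_le hρ hhalf hball hj z r
        _ ≤ _ := hfrost m z _ (by linarith) (by linarith)
        _ ≤ _ := by
          refine ENNReal.ofReal_le_ofReal ?_
          gcongr
          linarith
    · rw [liminf_const]

/-- **Mass distribution principle**. -/
lemma hausdorffMeasure_ne_zero_of_ball_le {ν : Measure ℂ} {C s R : ℝ} (hC : 0 < C) (hs : 0 < s)
    (hR : 0 < R) (hν : ∀ z r, 0 < r → r < R → ν (ball z r) ≤ ENNReal.ofReal (C * r ^ s))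
    {E : Set ℂ} (hE : ν E ≠ 0) : Measure.hausdorffMeasure s E ≠ 0 := by
  have hC0 : ENNReal.ofReal C ≠ 0 := by simpa using hC
  have hle : (ENNReal.ofReal C)⁻¹ • ν ≤ Measure.hausdorffMeasure s := by
    refine Measure.le_hausdorffMeasure s _ (ENNReal.ofReal (R / 2)) (by simpa using hR) ?_
    intro S hS
    rcases S.eq_empty_or_nonempty with rfl | ⟨x, hx⟩
    · simp
    have hfin : ediam S ≠ ⊤ := (hS.trans_lt ENNReal.ofReal_lt_top).ne
    have hbdd : Bornology.IsBounded S := isBounded_iff_ediam_ne_top.2 hfin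
    have hdR : diam S < R := by
      have : diam S ≤ R / 2 := ENNReal.toReal_le_of_le_ofReal (by positivity) hS
      linarith
    -- Letting r decrease to diam S avoids a loss in the constant and covers diameter zero.
    have hbound : ∀ r ∈ Set.Ioo (diam S) R, ν S ≤ ENNReal.ofReal (C * r ^ s) := by
      intro r hr
      refine le_trans (measure_mono fun y hy => ?_) (hν x r (diam_nonneg.trans_lt hr.1) hr.2)
      exact (dist_le_diam_of_mem hbdd hy hx).trans_lt hr.1
    have hcont : Tendsto (fun r : ℝ => ENNReal.ofReal (C * r ^ s)) (𝓝[>] (diam S))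
        (𝓝 (ENNReal.ofReal (C * diam S ^ s))) := by
      refine (ENNReal.tendsto_ofReal ?_).mono_left nhdsWithin_le_nhds
      exact ((Real.continuousAt_rpow_const _ _ (Or.inr hs.le)).const_mul C).tendsto
    have hS' : ν S ≤ ENNReal.ofReal (C * diam S ^ s) :=
      ge_of_tendsto hcont (mem_of_superset (Ioo_mem_nhdsGT hdR) hbound)
    rw [ENNReal.ofReal_mul hC.le, ← ENNReal.ofReal_rpow_of_nonneg diam_nonneg hs.le,
      diam, ENNReal.ofReal_toReal hfin] at hS'
    rw [Measure.smul_apply, smul_eq_mul, mul_comm, ← ENNReal.div_eq_inv_mul.trans (mul_comm _ _)]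
    exact ENNReal.div_le_of_le_mul' hS'
  intro h0
  have h := hle E
  rw [h0, Measure.smul_apply, smul_eq_mul, nonpos_iff_eq_zero, mul_eq_zero] at h
  rcases h with h | h
  · simp at h
  · exact hE h

/-! ### Lower bound -/

/-- The lower bound for the dimension of `V*_v`. -/
lemma le_dimH_approximableSetInSquare {v s : ℝ} (hv : 1 ≤ v) (hs : 0 < s) (hsv : s * (v + 1) < 4) :
    ENNReal.ofReal s ≤ dimH (approximableSetInSquare v) := by
  obtain ⟨A, hA, hA8⟩ : ∃ A : ℝ, 0 < A ∧ 1 ≤ A * (1 / 8 : ℝ) ^ s := by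
    refine ⟨8 ^ s, by positivity, ?_⟩
    rw [← Real.mul_rpow (by norm_num) (by norm_num)]
    norm_num
  let Stage := {x : PMF ℂ × ℝ // 0 < x.2 ∧
    ∀ z, x.1.toOuterMeasure (closedBall z (6 * x.2)) ≤ ENNReal.ofReal (A * x.2 ^ s)}
  have hstep (k : ℕ) (x : Stage) := exists_refinement hv hs hsv hA.le k x.2.1 x.2.2
  choose next rad hpos hhalf hfrost hfrost' hball hsupp hfrac using hstep
  -- Starting from the centre with radius 1/8 keeps the limit set within 1/4 of it, inside the
  -- square.
  let x₀ : ℂ := ⟨1 / 2, 1 / 2⟩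
  let start : Stage := ⟨(PMF.pure x₀, 1 / 8), by norm_num, fun z => by
    refine ((PMF.pure x₀).toOuterMeasure.mono (Set.subset_univ _)).trans
      (((PMF.toOuterMeasure_apply_eq_one_iff _ _).2 (Set.subset_univ _)).le.trans ?_)
    rw [← ENNReal.ofReal_one]
    exact ENNReal.ofReal_le_ofReal hA8⟩
  let f : ℕ → Stage := fun n =>
    n.rec start fun k x => ⟨(next k x, rad k x), hpos k x, hfrost k x⟩
  let μ : ℕ → PMF ℂ := fun k => (f k).1.1
  let ρ : ℕ → ℝ := fun k => (f k).1.2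
  have hμ0 : (μ 0).support = {x₀} := PMF.support_pure x₀
  have hρ : ∀ k, 0 < ρ k := fun k => (f k).2.1
  obtain ⟨ν, hνp, hνnull, hνball⟩ := exists_limit_measure (μ := μ) (ρ := ρ)
    (C := 2000000000 * A) (s := s) (by positivity) hs.le hρ
    (fun k => hhalf k (f k)) hμ0 (fun k => hsupp k (f k)) (fun k => hball k (f k))
    fun k => hfrost' k (f k)
  let E : Set ℂ := ⋂ k, cthickening (2 * ρ k) (μ k).support
  have hνE : ν E ≠ 0 := by
    have h0 : ν Eᶜ = 0 := by
      rw [Set.compl_iInter]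
      exact measure_iUnion_null hνnull
    have hEm : MeasurableSet E := MeasurableSet.iInter fun k => isClosed_cthickening.measurableSet
    rw [(prob_compl_eq_zero_iff hEm).1 h0]
    exact one_ne_zero
  have hEsub : E ⊆ approximableSetInSquare v := by
    intro z hz
    rw [Set.mem_iInter] at hz
    constructor
    · change Set.Infinite _
      intro hfin
      obtain ⟨B, hB⟩ := (hfin.image fun pq : GaussianInt × GaussianInt => ‖(pq.2 : ℂ)‖).bddAbove
      obtain ⟨k, hk⟩ := exists_nat_gt B
      -- Passing from 2ρ to 4ρ yields the strict inequality; the fraction found has height at least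
      -- k > B.
      have hz' := cthickening_subset_thickening' (by have := hρ (k + 1); positivity)
        (by linarith [hρ (k + 1)] : 2 * ρ (k + 1) < 4 * ρ (k + 1)) _ (hz (k + 1))
      obtain ⟨y, hy, hzy⟩ := mem_thickening_iff.1 hz'
      obtain ⟨p, q, hq, hkq, hρq, rfl⟩ := hfrac k (f k) y hy
      have hmem : ‖(q : ℂ)‖ ≤ B := hB ⟨(p, q), ⟨hq, by
        rw [← dist_eq_norm]
        exact hzy.trans_le hρq⟩, rfl⟩
      linarith
    · have h0 := hz 0
      have hdist : dist z x₀ ≤ 1 / 4 := by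
        rw [hμ0, cthickening_singleton _ (by have := hρ 0; positivity)] at h0
        refine (mem_closedBall.1 h0).trans (le_of_eq ?_)
        change 2 * (1 / 8 : ℝ) = 1 / 4
        norm_num
      rw [dist_eq_norm] at hdist
      have hre := abs_le.1 ((Complex.abs_re_le_norm _).trans hdist)
      have him := abs_le.1 ((Complex.abs_im_le_norm _).trans hdist)
      simp only [Complex.sub_re, Complex.sub_im, x₀] at hre him
      exact ⟨⟨by linarith [hre.1], by linarith [hre.2]⟩, by linarith [him.1], by linarith [him.2]⟩
  have hH : Measure.hausdorffMeasure s E ≠ 0 := by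
    refine hausdorffMeasure_ne_zero_of_ball_le (C := 2000000000 * A * 3 ^ s) (R := ρ 0)
      (by positivity) hs (hρ 0) (fun z r hr hrρ => ?_) hνE
    refine (hνball z r hr hrρ).trans (le_of_eq ?_)
    rw [Real.mul_rpow (by norm_num) hr.le, mul_assoc _ (3 ^ s)]
  rw [ENNReal.ofReal]
  refine (le_dimH_of_hausdorffMeasure_ne_zero ?_).trans (dimH_mono hEsub)
  rwa [Real.coe_toNNReal _ hs.le]

/-! ### Upper bound -/

/-- Hausdorff–Cantelli lemma: a limsup set with summable diameters is a null set. -/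
lemma hausdorffMeasure_setOf_infinite_mem_eq_zero {X ι : Type*} [MetricSpace X] [MeasurableSpace X]
    [BorelSpace X] [Countable ι] {d : ℝ} (hd : 0 < d) {t : ι → Set X}
    (ht : ∑' i, ediam (t i) ^ d ≠ ⊤) :
    Measure.hausdorffMeasure d {z | {i | z ∈ t i}.Infinite} = 0 := by
  have htail := ENNReal.tendsto_tsum_compl_atTop_zero ht
  -- Each diameter outside F is at most the tail sum to the power 1/d, which serves as mesh size.
  have hr : Tendsto (fun F : Finset ι => (∑' i : {i // i ∉ F}, ediam (t i) ^ d) ^ d⁻¹) atTop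
      (𝓝 0) := by
    have := (ENNReal.continuous_rpow_const (y := d⁻¹)).tendsto 0 |>.comp htail
    rwa [ENNReal.zero_rpow_of_pos (inv_pos.2 hd)] at this
  have h := Measure.hausdorffMeasure_le_liminf_tsum d {z | {i | z ∈ t i}.Infinite} _ hr
    (fun (F : Finset ι) (i : {i // i ∉ F}) => t i)
    (Eventually.of_forall fun F i => by
      rw [ENNReal.le_rpow_inv_iff hd]
      exact ENNReal.le_tsum (f := fun i : {i // i ∉ F} => ediam (t i) ^ d) i)
    (Eventually.of_forall fun F z hz => by
      obtain ⟨i, hi, hiF⟩ := Set.Infinite.exists_notMem_finset hz F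
      exact Set.mem_iUnion.2 ⟨⟨i, hiF⟩, hi⟩)
  rw [htail.liminf_eq] at h
  exact le_antisymm h zero_le

/-- The sup norm on ℤ² is at most the Euclidean norm, so the Eisenstein series bound dominates. -/
lemma GaussianInt.summable_norm_rpow_neg {k : ℝ} (hk : 2 < k) :
    Summable fun q : GaussianInt => if q = 0 then 0 else ‖(q : ℂ)‖ ^ (-k) := by
  have hinj : Function.Injective fun q : GaussianInt => ![q.re, q.im] := by
    intro a b hab
    have h0 := congrFun hab 0
    have h1 := congrFun hab 1
    exact Zsqrtd.ext h0 h1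
  refine Summable.of_nonneg_of_le (fun q => by split_ifs <;> positivity) (fun q => ?_)
    ((EisensteinSeries.summable_one_div_norm_rpow hk).comp_injective hinj)
  simp only [Function.comp_apply]
  split_ifs with hq
  · positivity
  · have hpos : 0 < ‖![q.re, q.im]‖ := by
      rw [norm_pos_iff]
      intro h
      exact hq (hinj (by simpa using h))
    refine Real.rpow_le_rpow_of_nonpos hpos ?_ (by linarith)
    refine (pi_norm_le_iff_of_nonneg (_root_.norm_nonneg _)).2 fun i => ?_
    fin_cases i
    · simpa [Int.norm_eq_abs] using Complex.abs_re_le_norm (q : ℂ)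
    · simpa [Int.norm_eq_abs] using Complex.abs_im_le_norm (q : ℂ)

/-- The upper bound for the dimension of `W*_v`. -/
lemma dimH_approximableSet_le {v s : ℝ} (hv : -1 < v) (hs : 0 < s) (hsv : 4 < s * (v + 1)) :
    dimH (approximableSet v) ≤ ENNReal.ofReal s := by
  classical
  have hcover : approximableSet v ⊆ ⋃ R : ℕ, approximableSet v ∩ closedBall 0 R := by
    intro z hz
    obtain ⟨R, hR⟩ := exists_nat_ge ‖z‖
    exact Set.mem_iUnion.2 ⟨R, hz, by simpa using hR⟩
  refine (dimH_mono hcover).trans ?_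
  rw [dimH_iUnion]
  refine iSup_le fun R => ?_
  rw [ENNReal.ofReal]
  refine dimH_le_of_hausdorffMeasure_ne_top ?_
  rw [Real.coe_toNNReal _ hs.le]
  -- The approximation radius is at most 1, so only numerators with ‖p‖ ≤ (R+1)‖q‖ matter.
  let t : GaussianInt × GaussianInt → Set ℂ := fun pq =>
    if pq.2 ≠ 0 ∧ dist (pq.1 : ℂ) 0 ≤ (R + 1) * ‖(pq.2 : ℂ)‖ then
      ball ((pq.1 : ℂ) / (pq.2 : ℂ)) (1 / ‖(pq.2 : ℂ)‖ ^ (v + 1)) else ∅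
  have hsub : approximableSet v ∩ closedBall 0 R ⊆ {z | {i | z ∈ t i}.Infinite} := by
    rintro z ⟨hz, hzR⟩
    refine Set.Infinite.mono ?_ hz
    rintro ⟨p, q⟩ ⟨hq, hpq⟩
    have hq1 := GaussianInt.one_le_norm_toComplex hq
    have hle : 1 / ‖(q : ℂ)‖ ^ (v + 1) ≤ 1 := by
      rw [div_le_one (by positivity)]
      exact Real.one_le_rpow hq1 (by linarith)
    have hdiv : ‖(p : ℂ) / (q : ℂ)‖ ≤ R + 1 := by
      have := norm_sub_norm_le ((p : ℂ) / (q : ℂ)) z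
      rw [norm_sub_rev] at this
      have hzR' : ‖z‖ ≤ R := by simpa using hzR
      dsimp only at hpq
      linarith
    rw [norm_div, div_le_iff₀ (by linarith)] at hdiv
    change z ∈ t (p, q)
    simp only [t]
    rw [if_pos ⟨hq, by simpa using hdiv⟩, mem_ball, dist_eq_norm]
    exact hpq
  have hinner (q : GaussianInt) : ∑' p : GaussianInt, ediam (t (p, q)) ^ s ≤
      ENNReal.ofReal (10 * (R + 1) ^ 2 * 2 ^ s *
        if q = 0 then 0 else ‖(q : ℂ)‖ ^ (-(s * (v + 1) - 2))) := by
    by_cases hq : q = 0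
    · simp [t, hq, ENNReal.zero_rpow_of_pos hs]
    have hq1 := GaussianInt.one_le_norm_toComplex hq
    have hq0 : 0 < ‖(q : ℂ)‖ := by linarith
    let F := (GaussianInt.finite_setOf_dist_le 0 ((R + 1) * ‖(q : ℂ)‖)).toFinset
    have hF : (F.card : ℝ) ≤ 2 + 8 * ((R + 1) * ‖(q : ℂ)‖) ^ 2 :=
      GaussianInt.card_le_of_dist_le (by positivity) (w := 0) fun p hp => by simpa [F] using hp
    rw [tsum_eq_sum (s := F) fun p hp => ?_]
    · have hterm : ∀ p ∈ F, ediam (t (p, q)) ^ s ≤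
          ENNReal.ofReal ((2 * (1 / ‖(q : ℂ)‖ ^ (v + 1))) ^ s) := by
        intro p hp
        rw [← ENNReal.ofReal_rpow_of_nonneg (by positivity) hs.le]
        refine ENNReal.rpow_le_rpow ?_ hs.le
        simp only [t]
        split_ifs
        · rw [← eball_ofReal]
          refine ediam_eball_le.trans (le_of_eq ?_)
          rw [ENNReal.ofReal_mul (by norm_num), ENNReal.ofReal_ofNat]
        · simp
      refine (Finset.sum_le_sum hterm).trans ?_
      rw [Finset.sum_const, nsmul_eq_mul, ← ENNReal.ofReal_natCast,
        ← ENNReal.ofReal_mul (by positivity), if_neg hq]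
      refine ENNReal.ofReal_le_ofReal ?_
      have e : (2 * (1 / ‖(q : ℂ)‖ ^ (v + 1))) ^ s = 2 ^ s * ‖(q : ℂ)‖ ^ (-(s * (v + 1))) := by
        rw [Real.mul_rpow (by norm_num) (by positivity), one_div, ← Real.rpow_neg hq0.le,
          ← Real.rpow_mul hq0.le]
        ring_nf
      have e' : ‖(q : ℂ)‖ ^ (-(s * (v + 1) - 2)) =
          ‖(q : ℂ)‖ ^ (-(s * (v + 1))) * ‖(q : ℂ)‖ ^ 2 := by
        rw [← Real.rpow_add_natCast hq0.ne']
        congr 1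
        push_cast
        ring
      have hRq : 1 ≤ ((R + 1) * ‖(q : ℂ)‖) ^ 2 := by
        refine one_le_pow₀ ?_
        nlinarith [(Nat.cast_nonneg R : (0 : ℝ) ≤ R)]
      calc (F.card : ℝ) * (2 * (1 / ‖(q : ℂ)‖ ^ (v + 1))) ^ s
          ≤ (10 * ((R + 1) * ‖(q : ℂ)‖) ^ 2) * (2 * (1 / ‖(q : ℂ)‖ ^ (v + 1))) ^ s := by
            gcongr
            linarith
        _ = _ := by
            rw [e, e']
            ring
    · have : ¬ dist (p : ℂ) 0 ≤ (R + 1) * ‖(q : ℂ)‖ := by simpa [F] using hp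
      simp only [t]
      rw [if_neg fun h => this h.2]
      simp [hs]
  have hsum : ∑' i, ediam (t i) ^ s ≠ ⊤ := by
    rw [ENNReal.tsum_prod', ENNReal.tsum_comm]
    refine ((ENNReal.tsum_le_tsum hinner).trans_lt ?_).ne
    exact ((GaussianInt.summable_norm_rpow_neg (by linarith)).mul_left _).tsum_ofReal_lt_top
  have hctb : Countable GaussianInt := by
    have hinj : Function.Injective fun q : GaussianInt => (q.re, q.im) := fun a b h =>
      Zsqrtd.ext (congrArg Prod.fst h) (congrArg Prod.snd h)
    exact hinj.countable
  rw [measure_mono_null hsub (hausdorffMeasure_setOf_infinite_mem_eq_zero hs hsum)]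
  exact ENNReal.zero_ne_top

lemma approximableSet_anti {v w : ℝ} (hvw : v ≤ w) : approximableSet w ⊆ approximableSet v := by
  intro z hz
  refine Set.Infinite.mono ?_ hz
  rintro ⟨p, q⟩ ⟨hq, hpq⟩
  have hq1 := GaussianInt.one_le_norm_toComplex hq
  refine ⟨hq, hpq.trans_le ?_⟩
  exact one_div_le_one_div_of_le (by positivity)
    (Real.rpow_le_rpow_of_exponent_le hq1 (by linarith))

theorem mainTheorem1 (v : ℝ) :
    (1 ≤ v →
      dimH (approximableSetInSquare v) = ENNReal.ofReal (4 / (v + 1)) ∧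
      dimH (approximableSet v) = ENNReal.ofReal (4 / (v + 1))) ∧
    (v ≤ 1 →
      dimH (approximableSetInSquare v) = 2 ∧
      dimH (approximableSet v) = 2) := by
  have hlower {w : ℝ} (hw : 1 ≤ w) :
      ENNReal.ofReal (4 / (w + 1)) ≤ dimH (approximableSetInSquare w) := by
    have hw0 : 0 < w + 1 := by linarith
    refine le_of_tendsto ((ENNReal.continuous_ofReal.tendsto _).mono_left
      (nhdsWithin_le_nhds (s := Set.Iio (4 / (w + 1))))) ?_
    filter_upwards [Ioo_mem_nhdsLT (by positivity : 0 < 4 / (w + 1))] with s hs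
    exact le_dimH_approximableSetInSquare hw hs.1 ((lt_div_iff₀ hw0).1 hs.2)
  have hinter (w : ℝ) : dimH (approximableSetInSquare w) ≤ dimH (approximableSet w) :=
    dimH_mono Set.inter_subset_left
  constructor
  · intro hv
    have hv0 : 0 < v + 1 := by linarith
    have hupper : dimH (approximableSet v) ≤ ENNReal.ofReal (4 / (v + 1)) := by
      refine ge_of_tendsto ((ENNReal.continuous_ofReal.tendsto _).mono_left
        (nhdsWithin_le_nhds (s := Set.Ioi (4 / (v + 1))))) ?_
      filter_upwards [self_mem_nhdsWithin] with s hs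
      exact dimH_approximableSet_le (by linarith) (lt_trans (by positivity) hs)
        ((div_lt_iff₀ hv0).1 hs)
    exact ⟨le_antisymm ((hinter v).trans hupper) (hlower hv),
      le_antisymm hupper ((hlower hv).trans (hinter v))⟩
  · intro hv
    have hupper : dimH (approximableSet v) ≤ 2 := by
      refine (dimH_mono (Set.subset_univ _)).trans ?_
      rw [Real.dimH_univ_eq_finrank, Complex.finrank_real_complex]
      norm_num
    have hlow : 2 ≤ dimH (approximableSetInSquare v) := by
      have h := (hlower le_rfl).trans
        (dimH_mono (Set.inter_subset_inter_left unitSquare (approximableSet_anti hv)))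
      -- The case v = 1 supplies 4/(1+1) = 2.
      norm_num at h
      exact h
    exact ⟨le_antisymm ((hinter v).trans hupper) hlow,
      le_antisymm hupper (hlow.trans (hinter v))⟩
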